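/- Let $K_n$ be the complete graph on the vertex set $[n]=\{1,\dots,n\}$. A path system on $[n]$ assigns to every pair $u,v\in[n]$ one simple path $P_{u,v}$ of $K_n$ between $u$ and $v$, where $P_{u,v}$ and $P_{v,u}$ are the same undirected path (and $P_{u,u}$ is the single vertex $u$). It is strictly metric if there is a weight function $w:E(K_n)\to\mathbb{R}_{>0}$ such that for all $u,v\in[n]$ the path $P_{u,v}$ is the unique simple path between $u$ and $v$ of minimum total $w$-weight. Let $\mathscr{S}_n$ be the set of all strictly metric path systems on $[n]$. Then $$2^{0.51\,n^2(1-o(1))}\;\le\;|\mathscr{S}_n|\;\le\;2^{1.38\,n^2(1-o(1))}.$$ That is, each $\mathscr{S}_n$ is finite, and there are sequences $(\varepsilon_n)_{n\ge 0}$ and $(\delta_n)_{n\ge 0}$ of non-negative real numbers, both tending to $0$ as $n\to\infty$, such that $$2^{0.51\,n^2(1-\varepsilon_n)}\;\le\;|\mathscr{S}_n|\;\le\;2^{1.38\,n^2(1-\delta_n)}\qquad\text{for all } n\ge 0.$$ -/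

import Mathlib

open Filter Topology

/-- A path system in a graph `G`: a choice, for every pair of vertices `u`, `v`, of exactly one
simple path `P u v` of `G` between them, where `P u v` and `P v u` are the same undirected path. -/
@[ext]
structure PathSystem {V : Type*} (G : SimpleGraph V) where
  path : ∀ u v : V, G.Path u v
  path_symm : ∀ u v : V, path v u = (path u v).reverse

/-- The total `w`-weight of the edges traversed by a walk. -/
def walkWeight {V : Type*} {G : SimpleGraph V} (w : Sym2 V → ℝ) {u v : V} (p : G.Walk u v) : ℝ :=
  (p.edges.map w).sum

/-- A path system is strictly metric if there are positive edge weights for which each of its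
paths is the unique shortest path between its end vertices. Only the values of `w` on the edges
of `G` matter. -/
def PathSystem.IsStrictlyMetric {V : Type*} {G : SimpleGraph V} (P : PathSystem G) : Prop :=
  ∃ w : Sym2 V → ℝ, (∀ e ∈ G.edgeSet, 0 < w e) ∧
    ∀ (u v : V) (q : G.Path u v), q ≠ P.path u v →
      walkWeight w (P.path u v : G.Walk u v) < walkWeight w (q : G.Walk u v)

/-- The set of all strictly metric path systems in `G`. -/
def strictlyMetricSystems {V : Type*} (G : SimpleGraph V) : Set (PathSystem G) :=
  {P | P.IsStrictlyMetric}

/-- The set of all strictly metric path systems on the vertex set `{0, …, n - 1}`, i.e. in the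
complete graph on it. -/
def strictlyMetricSystemsOn (n : ℕ) : Set (PathSystem (⊤ : SimpleGraph (Fin n))) :=
  strictlyMetricSystems ⊤

/-! Upper bound. Orient each of the m = C(n,2) pairs as (u, v), let x be the vertex after u on the
path from u to v, and record only the multiset of all pairs ux and xv, as a multiplicity vector of
total at most 2m. If P and Q have the same vector, then the total P-length of Q's two-step detours
equals that of P's own, which is the sum of all P-distances. The triangle inequality bounds each
term, so every detour is tight: Q's next vertex lies on P's shortest path, and conversely. Induction
on path length gives P = Q (`PathSystem.eq_of_dist_next`, `PathSystem.code_injOn`). There are at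
most (27/4)^m vectors, and log₂(27/4) < 2.76.

Lower bound. On N vertices take any graph E, give its edges weights near 1 and non-edges weight 3,
and join a hub to every vertex by weight 1.45. A non-edge then loses to the hub detour of weight
2.9, so the system determines E, which gives 2^(N(N-1)/2) systems. For further choices, light
weights grow quadratically with the length of the pair, so a non-adjacent pair (a, v) is joined
through the common neighbour nearest its midpoint. When two such neighbours x < y are symmetric
about the midpoint, the sign of a dominating perturbation on (a, y) breaks the tie, and these signs
are free (`IsTie.next_eq`). For about N²/4 pairs (a, y) a random E has such a tie with probability
at least 1/32 + 1/64 = 3/64. By convexity this adds 3N²/256 to the exponent, and 1/2 + 3/256 > 0.51.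
Remaining ties are broken generically (`exists_isStrictlyMetric_isMinimizing`). -/

theorem SimpleGraph.Walk.IsPath.eq_nil_of_closed {V : Type*} {G : SimpleGraph V} {u : V}
    {p : G.Walk u u} (hp : p.IsPath) : p = SimpleGraph.Walk.nil :=
  (SimpleGraph.Walk.isPath_iff_nil.1 hp).eq_nil

/-! ### Weights of walks -/

section WalkWeight

variable {V : Type*} {G : SimpleGraph V} {w : Sym2 V → ℝ}

theorem List.Sublist.sum_map_le_of_pos {α : Type*} {f : α → ℝ} {l₁ l₂ : List α}
    (h : l₁.Sublist l₂) (hf : ∀ a ∈ l₂, 0 < f a) :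
    (l₁.map f).sum ≤ (l₂.map f).sum ∧ (l₁ ≠ l₂ → (l₁.map f).sum < (l₂.map f).sum) := by
  induction h with
  | slnil => simp
  | cons a _ ih =>
    have h1 := ih fun b hb => hf b (by simp [hb])
    have h2 := hf a (by simp)
    simp only [List.map_cons, List.sum_cons]
    exact ⟨by linarith [h1.1], fun _ => by linarith [h1.1]⟩
  | cons_cons a _ ih =>
    have h1 := ih fun b hb => hf b (by simp [hb])
    simp only [List.map_cons, List.sum_cons]
    refine ⟨by linarith [h1.1], fun hne => ?_⟩
    have := h1.2 fun h => hne (by rw [h])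
    linarith

@[simp] theorem walkWeight_nil (u : V) :
    walkWeight w (SimpleGraph.Walk.nil : G.Walk u u) = 0 := by
  simp [walkWeight]

@[simp] theorem walkWeight_cons {u v x : V} (h : G.Adj u v) (p : G.Walk v x) :
    walkWeight w (SimpleGraph.Walk.cons h p) = w s(u, v) + walkWeight w p := by
  simp [walkWeight]

theorem walkWeight_append {u v x : V} (p : G.Walk u v) (q : G.Walk v x) :
    walkWeight w (p.append q) = walkWeight w p + walkWeight w q := by
  simp [walkWeight]

theorem walkWeight_reverse {u v : V} (p : G.Walk u v) :
    walkWeight w p.reverse = walkWeight w p := by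
  simp [walkWeight, List.sum_reverse]

theorem walkWeight_bypass_le [DecidableEq V] (hw : ∀ e ∈ G.edgeSet, 0 < w e) {u v : V}
    (p : G.Walk u v) :
    walkWeight w p.bypass ≤ walkWeight w p :=
  (p.edges_bypass_sublist_edges.sum_map_le_of_pos
    fun e he => hw e (p.edges_subset_edgeSet he)).1

theorem walkWeight_bypass_lt [DecidableEq V] (hw : ∀ e ∈ G.edgeSet, 0 < w e) {u v : V}
    {p : G.Walk u v} (hp : ¬ p.IsPath) :
    walkWeight w p.bypass < walkWeight w p := by
  refine (p.edges_bypass_sublist_edges.sum_map_le_of_pos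
    fun e he => hw e (p.edges_subset_edgeSet he)).2 fun h => hp ?_
  have h1 := congrArg List.length h
  simp only [SimpleGraph.Walk.length_edges] at h1
  rw [← p.bypass_eq_self_of_length_le_length_bypass h1.ge]
  exact p.bypass_isPath

end WalkWeight

/-! ### Distances in a strictly metric system and its reconstruction -/

namespace PathSystem

variable {V : Type*} {G : SimpleGraph V} {w : Sym2 V → ℝ} {P Q : PathSystem G}

/-- The weight function `w` strictly induces the path system `P`. -/
def InducedBy (P : PathSystem G) (w : Sym2 V → ℝ) : Prop :=
  (∀ e ∈ G.edgeSet, 0 < w e) ∧ ∀ (u v : V) (q : G.Path u v), q ≠ P.path u v →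
    walkWeight w (P.path u v : G.Walk u v) < walkWeight w (q : G.Walk u v)

/-- The vertex following `u` on the path from `u` to `v`. -/
def next (P : PathSystem G) (u v : V) : V := (P.path u v : G.Walk u v).getVert 1

/-- The distance between `u` and `v` along the path system. -/
def dist (P : PathSystem G) (w : Sym2 V → ℝ) (u v : V) : ℝ :=
  walkWeight w (P.path u v : G.Walk u v)

theorem dist_comm (P : PathSystem G) (w : Sym2 V → ℝ) (u v : V) :
    P.dist w u v = P.dist w v u := by
  simp only [dist, P.path_symm u v]
  exact (walkWeight_reverse _).symm

theorem dist_self (P : PathSystem G) (w : Sym2 V → ℝ) (u : V) : P.dist w u u = 0 := by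
  have h := (P.path u u).2.eq_nil_of_closed
  simp [dist, h]

/-- The distance along the path system between the two ends of an unordered pair. -/
def symDist (P : PathSystem G) (w : Sym2 V → ℝ) : Sym2 V → ℝ :=
  Sym2.lift ⟨P.dist w, P.dist_comm w⟩

@[simp] theorem symDist_mk (P : PathSystem G) (w : Sym2 V → ℝ) (u v : V) :
    P.symDist w s(u, v) = P.dist w u v := rfl

namespace InducedBy

theorem dist_le_walkWeight (h : P.InducedBy w) {u v : V} (p : G.Walk u v) :
    P.dist w u v ≤ walkWeight w p := by
  classical
  refine le_trans ?_ (walkWeight_bypass_le h.1 p)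
  by_cases hp : p.toPath = P.path u v
  · rw [dist, ← hp]; rfl
  · exact (h.2 u v _ hp).le

/-- A walk that is not simple is strictly heavier than its bypass, so a walk attaining the distance
is simple and uniqueness applies. This turns equalities of distances into equalities of walks. -/
theorem eq_path_of_walkWeight_le (h : P.InducedBy w) {u v : V} {p : G.Walk u v}
    (hp : walkWeight w p ≤ P.dist w u v) : (P.path u v : G.Walk u v) = p := by
  classical
  have hpath : p.IsPath := by
    by_contra hc
    exact absurd (h.dist_le_walkWeight p.bypass) (by linarith [walkWeight_bypass_lt h.1 hc])
  by_contra hc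
  refine absurd (h.2 u v ⟨p, hpath⟩ fun h' => hc ?_) (not_lt.2 hp)
  rw [← h']

theorem dist_triangle (h : P.InducedBy w) (u x v : V) :
    P.dist w u v ≤ P.dist w u x + P.dist w x v := by
  rw [dist, dist, dist, ← walkWeight_append]
  exact h.dist_le_walkWeight _

theorem path_eq_append (h : P.InducedBy w) {u x v : V}
    (hx : P.dist w u x + P.dist w x v = P.dist w u v) :
    (P.path u v : G.Walk u v) = (P.path u x : G.Walk u x).append (P.path x v : G.Walk x v) := by
  apply h.eq_path_of_walkWeight_le
  rw [walkWeight_append]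
  exact hx.le

theorem dist_next_add (h : P.InducedBy w) {u v : V} (huv : u ≠ v) :
    P.dist w u (P.next u v) + P.dist w (P.next u v) v = P.dist w u v := by
  refine le_antisymm ?_ (h.dist_triangle _ _ _)
  unfold next
  rw [dist.eq_def P w u v]
  cases hp : (P.path u v : G.Walk u v) with
  | nil => exact absurd rfl huv
  | @cons _ x _ hadj p =>
    have h1 := h.dist_le_walkWeight (SimpleGraph.Walk.cons hadj SimpleGraph.Walk.nil)
    have h2 := h.dist_le_walkWeight p
    simp only [SimpleGraph.Walk.getVert_cons_succ, SimpleGraph.Walk.getVert_zero,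
      walkWeight_cons, walkWeight_nil] at h1 ⊢
    linarith

end InducedBy

theorem next_ne (P : PathSystem G) {u v : V} (huv : u ≠ v) : P.next u v ≠ u := by
  unfold next
  cases (P.path u v : G.Walk u v) with
  | nil => exact absurd rfl huv
  | cons hadj p => simpa using hadj.ne'

theorem length_pos (P : PathSystem G) {u v : V} (huv : u ≠ v) :
    0 < (P.path u v : G.Walk u v).length := by
  cases (P.path u v : G.Walk u v) with
  | nil => exact absurd rfl huv
  | cons hadj p => simp

theorem path_eq_of_next_eq {u v : V} (huv : u ≠ v) (h : P.next u v = v) (hadj : G.Adj u v) :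
    (P.path u v : G.Walk u v) = SimpleGraph.Walk.cons hadj SimpleGraph.Walk.nil := by
  have hp := (P.path u v).2
  unfold next at h
  generalize (P.path u v : G.Walk u v) = p at *
  cases p with
  | nil => exact absurd rfl huv
  | cons hadj p =>
    simp only [SimpleGraph.Walk.getVert_cons_succ, SimpleGraph.Walk.getVert_zero] at h
    subst h
    rw [hp.of_cons.eq_nil_of_closed]

theorem adj_of_next_eq {u v : V} (huv : u ≠ v) (h : P.next u v = v) : G.Adj u v := by
  unfold next at h
  cases hp : (P.path u v : G.Walk u v) with
  | nil => exact absurd rfl huv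
  | cons hadj p =>
    rw [hp] at h
    simp only [SimpleGraph.Walk.getVert_cons_succ, SimpleGraph.Walk.getVert_zero] at h
    exact h ▸ hadj

/-- Two strictly metric path systems agree if the first steps of each lie on shortest paths of the
other, for one orientation of each pair. -/
theorem eq_of_dist_next {w' : Sym2 V → ℝ} (hP : P.InducedBy w) (hQ : Q.InducedBy w')
    (hPQ : ∀ u v : V, u ≠ v →
      (P.dist w u (Q.next u v) + P.dist w (Q.next u v) v = P.dist w u v ∧
        Q.dist w' u (P.next u v) + Q.dist w' (P.next u v) v = Q.dist w' u v) ∨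
      (P.dist w v (Q.next v u) + P.dist w (Q.next v u) u = P.dist w v u ∧
        Q.dist w' v (P.next v u) + Q.dist w' (P.next v u) u = Q.dist w' v u)) :
    P = Q := by
  have key : ∀ (n : ℕ) (u v : V), (P.path u v : G.Walk u v).length = n →
      P.path u v = Q.path u v := by
    intro n
    induction n using Nat.strong_induction_on with
    | _ n ih =>
    have main : ∀ u v : V, u ≠ v → (P.path u v : G.Walk u v).length = n →
        P.dist w u (Q.next u v) + P.dist w (Q.next u v) v = P.dist w u v →
        Q.dist w' u (P.next u v) + Q.dist w' (P.next u v) v = Q.dist w' u v →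
        P.path u v = Q.path u v := by
      intro u v huv hn h1 h2
      have e1 := hP.path_eq_append h1
      have e2 := hQ.path_eq_append (hQ.dist_next_add huv)
      have e3 := hQ.path_eq_append h2
      -- If Q uses the edge uv, then `e3` splits a walk of length 1 at P's next vertex, which must
      -- therefore be v. Otherwise Q's next vertex splits both paths, and the two pieces of P's path
      -- are strictly shorter.
      by_cases hx : Q.next u v = v
      · have hQuv := path_eq_of_next_eq huv hx (adj_of_next_eq huv hx)
        have hl := congrArg SimpleGraph.Walk.length e3
        rw [hQuv, SimpleGraph.Walk.length_append] at hl
        have h3 := Q.length_pos (P.next_ne huv).symm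
        have hy : P.next u v = v := by
          by_contra hc
          have := Q.length_pos hc
          simp only [SimpleGraph.Walk.length_cons, SimpleGraph.Walk.length_nil] at hl
          omega
        apply Subtype.ext
        rw [hQuv, path_eq_of_next_eq huv hy (adj_of_next_eq huv hx)]
      · have hl := congrArg SimpleGraph.Walk.length e1
        rw [SimpleGraph.Walk.length_append] at hl
        have h3 := P.length_pos (Q.next_ne huv).symm
        have h4 := P.length_pos hx
        apply Subtype.ext
        rw [e1, e2, ih _ (by omega) u _ rfl, ih _ (by omega) _ v rfl]
    intro u v hn
    by_cases huv : u = v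
    · subst huv
      apply Subtype.ext
      rw [(P.path u u).2.eq_nil_of_closed,
        (Q.path u u).2.eq_nil_of_closed]
    · rcases hPQ u v huv with h | h
      · exact main u v huv hn h.1 h.2
      · rw [P.path_symm v u, Q.path_symm v u, main v u (Ne.symm huv) ?_ h.1 h.2]
        rw [← hn, P.path_symm u v]
        simp
  ext u v : 3
  exact key _ u v rfl

end PathSystem

/-! ### Upper bound: codes and their number -/

/-- There are at most `(27 / 4) ^ m` vectors of `m` natural numbers with sum at most `2 * m`. -/
theorem card_le_of_forall_sum_le {ι : Type*} [Fintype ι] (S : Finset (ι → ℕ))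
    (hS : ∀ c ∈ S, ∑ i, c i ≤ 2 * Fintype.card ι) :
    (S.card : ℝ) ≤ (27 / 4 : ℝ) ^ Fintype.card ι := by
  classical
  set m := Fintype.card ι
  have hsub : S ⊆ Fintype.piFinset fun _ : ι => Finset.range (2 * m + 1) := by
    intro c hc
    rw [Fintype.mem_piFinset]
    intro i
    have := Finset.single_le_sum (f := c) (fun _ _ => Nat.zero_le _) (Finset.mem_univ i)
    have := hS c hc
    simp only [Finset.mem_range]
    omega
  -- Weigh c by t ^ (∑ c i). The total is at most (1 - t)⁻¹ ^ m, while each c in S contributes at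
  -- least t ^ (2m). The choice t = 2/3 minimises 1 / ((1 - t) t²), with value 27/4.
  have h1 : ∑ c ∈ S, ∏ i, (2 / 3 : ℝ) ^ c i ≤ 3 ^ m := by
    calc ∑ c ∈ S, ∏ i, (2 / 3 : ℝ) ^ c i
        ≤ ∑ c ∈ Fintype.piFinset fun _ : ι => Finset.range (2 * m + 1),
            ∏ i, (2 / 3 : ℝ) ^ c i :=
          Finset.sum_le_sum_of_subset_of_nonneg hsub fun c _ _ => by positivity
      _ = ∏ _i : ι, ∑ j ∈ Finset.range (2 * m + 1), (2 / 3 : ℝ) ^ j :=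
          (Finset.prod_univ_sum _ _).symm
      _ ≤ ∏ _i : ι, (3 : ℝ) := by
          refine Finset.prod_le_prod (fun _ _ => by positivity) fun _ _ => ?_
          rw [geom_sum_eq (by norm_num)]
          have : (0 : ℝ) < (2 / 3) ^ (2 * m + 1) := by positivity
          rw [div_le_iff_of_neg (by norm_num)]
          linarith
      _ = 3 ^ m := by simp [m]
  have h2 : (S.card : ℝ) * (4 / 9) ^ m ≤ ∑ c ∈ S, ∏ i, (2 / 3 : ℝ) ^ c i := by
    rw [← nsmul_eq_mul, ← Finset.sum_const]
    refine Finset.sum_le_sum fun c hc => ?_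
    rw [Finset.prod_pow_eq_pow_sum, show (4 / 9 : ℝ) = (2 / 3) ^ 2 by norm_num, ← pow_mul]
    exact pow_le_pow_of_le_one (by norm_num) (by norm_num) (hS c hc)
  have h3 : (27 / 4 : ℝ) ^ m * (4 / 9) ^ m = 3 ^ m := by
    rw [← mul_pow]; norm_num
  have h4 : (0 : ℝ) < (4 / 9) ^ m := by positivity
  exact le_of_mul_le_mul_right (by rw [h3]; exact h2.trans h1) h4

namespace PathSystem

variable {n : ℕ}

/-- For each edge, one of its two orientations `(u, v)` is chosen, and the code counts how often
an edge is one of `s(u, x)`, `s(x, v)`, where `x` follows `u` on the path from `u` to `v`. -/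
noncomputable def code (P : PathSystem (⊤ : SimpleGraph (Fin n)))
    (e : {e : Sym2 (Fin n) // e ∈ (⊤ : SimpleGraph (Fin n)).edgeFinset}) : ℕ :=
  ∑ f : {e : Sym2 (Fin n) // e ∈ (⊤ : SimpleGraph (Fin n)).edgeFinset},
    ((if s(f.1.out.1, P.next f.1.out.1 f.1.out.2) = e.1 then 1 else 0) +
      (if s(P.next f.1.out.1 f.1.out.2, f.1.out.2) = e.1 then 1 else 0))

/-- When u = v no edge matches, which is harmless because the distance is 0. This occurs in codes
when the path is a single edge. -/
theorem sum_ite_mul_symDist (P : PathSystem (⊤ : SimpleGraph (Fin n))) (w : Sym2 (Fin n) → ℝ)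
    (u v : Fin n) :
    ∑ e : {e : Sym2 (Fin n) // e ∈ (⊤ : SimpleGraph (Fin n)).edgeFinset},
      ((if s(u, v) = e.1 then 1 else 0 : ℕ) : ℝ) * P.symDist w e.1 = P.dist w u v := by
  rw [Finset.sum_coe_sort _ fun e => ((if s(u, v) = e then 1 else 0 : ℕ) : ℝ) * P.symDist w e]
  by_cases huv : u = v
  · subst huv
    rw [dist_self]
    refine Finset.sum_eq_zero fun e he => ?_
    rw [if_neg]
    · simp
    · rintro rfl
      simp at he
  · rw [Finset.sum_eq_single s(u, v)]
    · simp
    · intro e _ hne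
      rw [if_neg hne.symm]; simp
    · intro h
      simp [huv] at h

theorem sum_code_mul_symDist (P Q : PathSystem (⊤ : SimpleGraph (Fin n)))
    (w : Sym2 (Fin n) → ℝ) :
    ∑ e, (Q.code e : ℝ) * P.symDist w e.1 =
      ∑ f : {e : Sym2 (Fin n) // e ∈ (⊤ : SimpleGraph (Fin n)).edgeFinset},
        (P.dist w f.1.out.1 (Q.next f.1.out.1 f.1.out.2) +
          P.dist w (Q.next f.1.out.1 f.1.out.2) f.1.out.2) := by
  simp only [code, Nat.cast_sum, Finset.sum_mul]
  rw [Finset.sum_comm]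
  refine Finset.sum_congr rfl fun f _ => ?_
  simp only [Nat.cast_add, add_mul, Finset.sum_add_distrib]
  rw [sum_ite_mul_symDist, sum_ite_mul_symDist]

theorem sum_code_le (P : PathSystem (⊤ : SimpleGraph (Fin n))) :
    ∑ e, P.code e ≤
      2 * Fintype.card {e : Sym2 (Fin n) // e ∈ (⊤ : SimpleGraph (Fin n)).edgeFinset} := by
  have h : ∀ a : Sym2 (Fin n),
      ∑ e : {e : Sym2 (Fin n) // e ∈ (⊤ : SimpleGraph (Fin n)).edgeFinset},
        (if a = e.1 then 1 else 0) ≤ 1 := by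
    intro a
    rw [Finset.sum_coe_sort _ fun e => if a = e then 1 else 0, Finset.sum_ite_eq]
    split_ifs <;> simp
  unfold code
  rw [Finset.sum_comm, mul_comm, ← smul_eq_mul, Fintype.card, ← Finset.sum_const]
  refine Finset.sum_le_sum fun f _ => ?_
  rw [Finset.sum_add_distrib]
  exact Nat.add_le_add (h _) (h _)

/-- Equal codes force equal totals of P-lengths. Each detour through Q's next vertex is at least the
P-distance, so equality of the sums is equality term by term. -/
theorem InducedBy.dist_eq_of_code_eq {P Q : PathSystem (⊤ : SimpleGraph (Fin n))}
    {w : Sym2 (Fin n) → ℝ} (hP : P.InducedBy w) (h : P.code = Q.code)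
    (f : {e : Sym2 (Fin n) // e ∈ (⊤ : SimpleGraph (Fin n)).edgeFinset}) :
    P.dist w f.1.out.1 (Q.next f.1.out.1 f.1.out.2) +
      P.dist w (Q.next f.1.out.1 f.1.out.2) f.1.out.2 = P.dist w f.1.out.1 f.1.out.2 := by
  have h1 := sum_code_mul_symDist P Q w
  rw [← h, sum_code_mul_symDist P P w] at h1
  have h2 : ∀ f : {e : Sym2 (Fin n) // e ∈ (⊤ : SimpleGraph (Fin n)).edgeFinset},
      P.dist w f.1.out.1 (P.next f.1.out.1 f.1.out.2) +
        P.dist w (P.next f.1.out.1 f.1.out.2) f.1.out.2 = P.dist w f.1.out.1 f.1.out.2 := by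
    intro f
    refine hP.dist_next_add fun hc => ?_
    have h3 : s(f.1.out.1, f.1.out.2) = f.1 := Quot.out_eq f.1
    have h4 := f.2
    rw [← h3, hc] at h4
    simp at h4
  rw [Finset.sum_congr rfl fun f _ => h2 f] at h1
  exact ((Finset.sum_eq_sum_iff_of_le fun f _ => hP.dist_triangle _ _ _).1 h1 f
    (Finset.mem_univ _)).symm

theorem code_injOn : Set.InjOn (code (n := n)) (strictlyMetricSystemsOn n) := by
  rintro P ⟨w, hw⟩ Q ⟨w', hw'⟩ h
  have hP : P.InducedBy w := hw
  have hQ : Q.InducedBy w' := hw'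
  refine eq_of_dist_next hP hQ fun u v huv => ?_
  let f : {e : Sym2 (Fin n) // e ∈ (⊤ : SimpleGraph (Fin n)).edgeFinset} :=
    ⟨s(u, v), by simpa using huv⟩
  have h1 := hP.dist_eq_of_code_eq h f
  have h2 := hQ.dist_eq_of_code_eq h.symm f
  have h3 : s(f.1.out.1, f.1.out.2) = s(u, v) := Quot.out_eq f.1
  rcases Sym2.eq_iff.1 h3 with ⟨h4, h5⟩ | ⟨h4, h5⟩
  · rw [h4, h5] at h1 h2
    exact Or.inl ⟨h1, h2⟩
  · rw [h4, h5] at h1 h2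
    exact Or.inr ⟨h1, h2⟩

end PathSystem

theorem finite_setOf_sum_le {ι : Type*} [Fintype ι] (k : ℕ) :
    {c : ι → ℕ | ∑ i, c i ≤ k}.Finite := by
  classical
  refine (Fintype.piFinset fun _ : ι => Finset.range (k + 1)).finite_toSet.subset fun c hc => ?_
  rw [Finset.mem_coe, Fintype.mem_piFinset]
  intro i
  have := Finset.single_le_sum (f := c) (fun _ _ => Nat.zero_le _) (Finset.mem_univ i)
  have : ∑ i, c i ≤ k := hc
  simp only [Finset.mem_range]
  omega

theorem strictlyMetricSystemsOn_finite (n : ℕ) : (strictlyMetricSystemsOn n).Finite :=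
  Set.Finite.of_finite_image ((finite_setOf_sum_le _).subset
    (Set.image_subset_iff.2 fun P _ => P.sum_code_le)) PathSystem.code_injOn

theorem ncard_strictlyMetricSystemsOn_le_pow (n : ℕ) :
    ((strictlyMetricSystemsOn n).ncard : ℝ) ≤ (27 / 4 : ℝ) ^ n.choose 2 := by
  classical
  have hfin := (strictlyMetricSystemsOn_finite n).image PathSystem.code
  rw [← PathSystem.code_injOn.ncard_image, Set.ncard_eq_toFinset_card _ hfin]
  refine (card_le_of_forall_sum_le hfin.toFinset fun c hc => ?_).trans_eq ?_
  · obtain ⟨P, _, rfl⟩ := hfin.mem_toFinset.1 hc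
    exact P.sum_code_le
  · rw [Fintype.card_coe, SimpleGraph.card_edgeFinset_top_eq_card_choose_two, Fintype.card_fin]

theorem ncard_strictlyMetricSystemsOn_le (n : ℕ) :
    ((strictlyMetricSystemsOn n).ncard : ℝ) ≤ (2 : ℝ) ^ ((1.38 : ℝ) * (n : ℝ) ^ 2) := by
  refine (ncard_strictlyMetricSystemsOn_le_pow n).trans ?_
  -- Raised to the power 25 the exponent becomes the integer 69.
  have h1 : (27 / 4 : ℝ) ≤ 2 ^ (2.76 : ℝ) := by
    rw [← Real.rpow_le_rpow_iff (z := (25 : ℝ)) (by norm_num) (by positivity) (by norm_num),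
      ← Real.rpow_mul (by norm_num)]
    norm_num
  calc (27 / 4 : ℝ) ^ n.choose 2 ≤ (2 ^ (2.76 : ℝ)) ^ n.choose 2 :=
        pow_le_pow_left₀ (by norm_num) h1 _
    _ = 2 ^ ((2.76 : ℝ) * n.choose 2) := by rw [Real.rpow_mul_natCast (by norm_num)]
    _ ≤ _ := by
        refine Real.rpow_le_rpow_of_exponent_le (by norm_num) ?_
        rw [Nat.cast_choose_two]
        nlinarith [(Nat.cast_nonneg n : (0 : ℝ) ≤ n)]

/-! ### Breaking ties between shortest paths -/

section Perturbation

variable {V : Type*} {G : SimpleGraph V}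

/-- A simple path has only one edge at its start, so the first edges agree. The rest of p avoids u,
so its edges lie in the rest of q. -/
theorem SimpleGraph.Walk.IsPath.eq_of_edges_subset {u v : V} {p q : G.Walk u v} (hp : p.IsPath)
    (hq : q.IsPath) (h : p.edges ⊆ q.edges) : p = q := by
  induction p with
  | nil => exact hq.eq_nil_of_closed.symm
  | @cons u x v hadj p ih =>
    have hx : x = q.snd := hq.eq_snd_of_mem_edges (h (by simp))
    cases q with
    | nil => simp at h
    | @cons _ y _ hadj' q =>
      obtain rfl : x = y := by simpa using hx
      rw [ih hp.of_cons hq.of_cons]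
      intro e he
      have h1 : e ∈ (SimpleGraph.Walk.cons hadj' q).edges := h (by simp [he])
      rw [SimpleGraph.Walk.edges_cons, List.mem_cons] at h1
      rcases h1 with rfl | h1
      · exact absurd (p.fst_mem_support_of_mem_edges he)
          ((SimpleGraph.Walk.cons_isPath_iff _ _).1 hp).2
      · exact h1

theorem walkWeight_add_mul (w b : Sym2 V → ℝ) (η : ℝ) {u v : V} (p : G.Walk u v) :
    walkWeight (fun e => w e + η * b e) p = walkWeight w p + η * walkWeight b p := by
  simp only [walkWeight]
  rw [List.sum_map_add, List.sum_map_mul_left]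

/-- Some positive weights separate all paths with common ends. -/
theorem exists_weight_injective [Finite V] :
    ∃ b : Sym2 V → ℝ, (∀ e, 0 < b e) ∧ ∀ (u v : V) (p q : G.Path u v),
      walkWeight b (p : G.Walk u v) = walkWeight b (q : G.Walk u v) → p = q := by
  classical
  have := Fintype.ofFinite V
  -- With weights that are distinct powers of 2, the weight of a path is a binary expansion that
  -- encodes its edge set.
  let idx : Sym2 V ↪ ℕ := (Fintype.equivFin (Sym2 V)).toEmbedding.trans Fin.valEmbedding
  have hsum : ∀ (u v : V) (p : G.Path u v), walkWeight (fun e => (2 : ℝ) ^ idx e)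
      (p : G.Walk u v) =
        ((∑ i ∈ (p : G.Walk u v).edges.toFinset.map idx, 2 ^ i : ℕ) : ℝ) := by
    intro u v p
    rw [Finset.sum_map, List.sum_toFinset _ p.2.isTrail.edges_nodup, walkWeight, Nat.cast_list_sum,
      List.map_map]
    congr 2
    ext e
    simp
  refine ⟨fun e => 2 ^ idx e, fun e => by positivity, fun u v p q h => ?_⟩
  rw [hsum, hsum, Nat.cast_inj] at h
  have h1 := Finset.map_injective _ (Finset.geomSum_injective le_rfl h)
  refine Subtype.ext (p.2.eq_of_edges_subset q.2 fun e he => ?_)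
  rw [← List.mem_toFinset] at he ⊢
  rwa [← h1]

/-- Here c and β stand for the differences of two paths in the original weight and in the separating
weight: a small η removes ties and keeps strict inequalities. -/
theorem eventually_add_mul_ne {c β : ℝ} (hβ : β ≠ 0) :
    ∀ᶠ η : ℝ in 𝓝[>] 0, c + η * β ≠ 0 ∧ (c < 0 → c + η * β < 0) := by
  have ht : Tendsto (fun η : ℝ => c + η * β) (𝓝[>] 0) (𝓝 c) := by
    have : Continuous fun η : ℝ => c + η * β := by fun_prop
    have h := (this.tendsto 0).mono_left (nhdsWithin_le_nhds (s := Set.Ioi 0))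
    simpa using h
  rcases lt_trichotomy c 0 with hc | rfl | hc
  · filter_upwards [ht.eventually_lt_const hc] with η h
    exact ⟨h.ne, fun _ => h⟩
  · filter_upwards [self_mem_nhdsWithin] with η h
    have h' : (0 : ℝ) < η := h
    exact ⟨by simp [h'.ne', hβ], fun h => absurd h (lt_irrefl _)⟩
  · filter_upwards [ht.eventually_const_lt hc] with η h
    exact ⟨h.ne', fun h' => absurd h' hc.not_gt⟩

/-- All paths of the system have minimal weight. -/
def PathSystem.IsMinimizing (P : PathSystem G) (w : Sym2 V → ℝ) : Prop :=
  ∀ (u v : V) (q : G.Path u v),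
    walkWeight w (P.path u v : G.Walk u v) ≤ walkWeight w (q : G.Walk u v)

/-- Ties between shortest paths can be broken so that a strictly metric system results. -/
theorem exists_isStrictlyMetric_isMinimizing [Finite V] (hG : G.Preconnected) {w : Sym2 V → ℝ}
    (hw : ∀ e ∈ G.edgeSet, 0 < w e) :
    ∃ P : PathSystem G, P.IsStrictlyMetric ∧ P.IsMinimizing w := by
  classical
  have := Fintype.ofFinite V
  obtain ⟨b, hb, hinj⟩ := exists_weight_injective (G := G)
  have hev : ∀ᶠ η : ℝ in 𝓝[>] 0, ∀ (u v : V) (p q : G.Path u v), p ≠ q →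
      (walkWeight w (p : G.Walk u v) - walkWeight w (q : G.Walk u v)) +
          η * (walkWeight b (p : G.Walk u v) - walkWeight b (q : G.Walk u v)) ≠ 0 ∧
        (walkWeight w (p : G.Walk u v) - walkWeight w (q : G.Walk u v) < 0 →
          (walkWeight w (p : G.Walk u v) - walkWeight w (q : G.Walk u v)) +
          η * (walkWeight b (p : G.Walk u v) - walkWeight b (q : G.Walk u v)) < 0) := by
    refine eventually_all.2 fun u => eventually_all.2 fun v => eventually_all.2 fun p =>
      eventually_all.2 fun q => ?_
    by_cases hpq : p = q
    · exact Eventually.of_forall fun _ h => absurd hpq h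
    · filter_upwards [eventually_add_mul_ne (sub_ne_zero.2 fun h => hpq (hinj u v p q h))]
        with η h _
      exact h
  obtain ⟨η, hη, hη0⟩ := (hev.and self_mem_nhdsWithin).exists
  have hη0' : (0 : ℝ) < η := hη0
  set w' : Sym2 V → ℝ := fun e => w e + η * b e with hw'
  have hne : ∀ (u v : V) (p q : G.Path u v), p ≠ q →
      walkWeight w' (p : G.Walk u v) ≠ walkWeight w' (q : G.Walk u v) := by
    intro u v p q hpq h
    rw [hw', walkWeight_add_mul, walkWeight_add_mul] at h
    exact (hη u v p q hpq).1 (by linarith)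
  have hlt : ∀ (u v : V) (p q : G.Path u v),
      walkWeight w (p : G.Walk u v) < walkWeight w (q : G.Walk u v) →
      walkWeight w' (p : G.Walk u v) < walkWeight w' (q : G.Walk u v) := by
    intro u v p q h
    have hpq : p ≠ q := by rintro rfl; exact lt_irrefl _ h
    have := (hη u v p q hpq).2 (by linarith)
    rw [hw', walkWeight_add_mul, walkWeight_add_mul]
    linarith
  have hmin : ∀ u v : V, ∃ p : G.Path u v, ∀ q : G.Path u v,
      walkWeight w' (p : G.Walk u v) ≤ walkWeight w' (q : G.Walk u v) := by
    intro u v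
    have : Nonempty (G.Path u v) := ⟨(hG u v).some.toPath⟩
    exact Finite.exists_min fun p : G.Path u v => walkWeight w' (p : G.Walk u v)
  choose p hp using hmin
  have hp' : ∀ (u v : V) (q : G.Path u v), q ≠ p u v →
      walkWeight w' (p u v : G.Walk u v) < walkWeight w' (q : G.Walk u v) := fun u v q h =>
    lt_of_le_of_ne (hp u v q) (hne u v _ _ h.symm)
  refine ⟨⟨p, fun u v => ?_⟩, ⟨w', fun e he => ?_, hp'⟩, fun u v q => ?_⟩
  -- Reversal preserves weight, so symmetry follows from uniqueness of the minimiser.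
  · by_contra hc
    have h1 := hp' v u (p u v).reverse (Ne.symm hc)
    have h2 := hp u v (p v u).reverse
    rw [SimpleGraph.Path.reverse_coe, walkWeight_reverse] at h1 h2
    exact absurd h1 h2.not_gt
  · have := hw e he
    have := mul_pos hη0' (hb e)
    simp only [hw']
    linarith
  · by_contra hc
    exact absurd (hlt u v _ _ (not_le.1 hc)) (hp u v q).not_gt

end Perturbation

/-! ### Short paths when all weights are at least 1 -/

namespace PathSystem

variable {V : Type*} {w : Sym2 V → ℝ} {P : PathSystem (⊤ : SimpleGraph V)}

theorem length_le_walkWeight (hw : ∀ u v : V, u ≠ v → 1 ≤ w s(u, v)) {u v : V}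
    (p : (⊤ : SimpleGraph V).Walk u v) : (p.length : ℝ) ≤ walkWeight w p := by
  induction p with
  | nil => simp
  | cons h p ih =>
    have := hw _ _ h.ne
    rw [walkWeight_cons, SimpleGraph.Walk.length_cons]
    push_cast
    linarith

theorem IsMinimizing.le_edge (hP : P.IsMinimizing w) {u v : V} (huv : u ≠ v) :
    walkWeight w (P.path u v : (⊤ : SimpleGraph V).Walk u v) ≤ w s(u, v) := by
  have h := hP u v (SimpleGraph.Path.singleton ((SimpleGraph.top_adj u v).2 huv))
  simpa [SimpleGraph.Path.singleton] using h

theorem IsMinimizing.le_two_edges (hP : P.IsMinimizing w) {u x v : V} (huv : u ≠ v)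
    (hux : u ≠ x) (hxv : x ≠ v) :
    walkWeight w (P.path u v : (⊤ : SimpleGraph V).Walk u v) ≤ w s(u, x) + w s(x, v) := by
  have h := hP u v ⟨SimpleGraph.Walk.cons ((SimpleGraph.top_adj u x).2 hux)
    (SimpleGraph.Walk.cons ((SimpleGraph.top_adj x v).2 hxv) SimpleGraph.Walk.nil), by
      simp [huv, hux, hxv]⟩
  simpa using h

/-- If all weights are at least `1`, a unique shortest path of two edges of weight less than `3` is
the one in a minimizing system. -/
theorem IsMinimizing.next_eq_mid (hP : P.IsMinimizing w) (hw : ∀ u v : V, u ≠ v → 1 ≤ w s(u, v))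
    {u x v : V} (huv : u ≠ v) (hux : u ≠ x) (hxv : x ≠ v) (h3 : w s(u, x) + w s(x, v) < 3)
    (hedge : w s(u, x) + w s(x, v) < w s(u, v))
    (hmid : ∀ z, z ≠ u → z ≠ v → z ≠ x → w s(u, x) + w s(x, v) < w s(u, z) + w s(z, v)) :
    P.next u v = x := by
  have hle := hP.le_two_edges huv hux hxv
  unfold next
  cases hp : (P.path u v : (⊤ : SimpleGraph V).Walk u v) with
  | nil => exact absurd rfl huv
  | @cons _ y _ h p =>
    rw [hp] at hle
    cases p with
    | nil => rw [walkWeight_cons, walkWeight_nil] at hle; linarith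
    | @cons _ y' _ h' p =>
      cases p with
      | nil =>
        simp only [SimpleGraph.Walk.getVert_cons_succ, SimpleGraph.Walk.getVert_zero]
        by_contra hyx
        have := hmid y h.ne' h'.ne hyx
        simp only [walkWeight_cons, walkWeight_nil] at hle
        linarith
      | cons h'' p =>
        have h1 := hw _ _ h.ne
        have h2 := hw _ _ h'.ne
        have h4 := hw _ _ h''.ne
        have h5 := length_le_walkWeight hw p
        simp only [walkWeight_cons] at hle
        have : (0 : ℝ) ≤ p.length := Nat.cast_nonneg _
        linarith

/-- If all weights are at least `1`, an edge of weight less than `2` is in a minimizing system. -/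
theorem IsMinimizing.next_eq_of_lt_two (hP : P.IsMinimizing w)
    (hw : ∀ u v : V, u ≠ v → 1 ≤ w s(u, v)) {u v : V} (huv : u ≠ v) (h : w s(u, v) < 2) :
    P.next u v = v := by
  have hle := hP.le_edge huv
  unfold next
  cases hp : (P.path u v : (⊤ : SimpleGraph V).Walk u v) with
  | nil => exact absurd rfl huv
  | @cons _ y _ h p =>
    rw [hp] at hle
    cases p with
    | nil => simp
    | @cons _ y' _ h' p =>
      have h1 := hw _ _ h.ne
      have h2 := hw _ _ h'.ne
      have h5 := length_le_walkWeight hw p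
      simp only [walkWeight_cons] at hle
      have : (0 : ℝ) ≤ p.length := Nat.cast_nonneg _
      linarith

theorem IsMinimizing.next_ne_of_detour (hP : P.IsMinimizing w) {u x v : V} (huv : u ≠ v)
    (hux : u ≠ x) (hxv : x ≠ v) (h : w s(u, x) + w s(x, v) < w s(u, v)) :
    P.next u v ≠ v := by
  intro hn
  have hle := hP.le_two_edges huv hux hxv
  rw [path_eq_of_next_eq huv hn ((SimpleGraph.top_adj u v).2 huv), walkWeight_cons,
    walkWeight_nil] at hle
  linarith

end PathSystem

/-! ### Lower bound: weights with prescribed light pairs and tie-breaks -/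

section TieWeights

/-- A perturbation of the weight of the pair `(a, b)`, whose size increases with `b - a` and, for
fixed `b - a`, decreases with `a`, with negative sign on `σ`. -/
noncomputable def pert (N : ℕ) (σ : Finset (ℕ × ℕ)) (a b : ℕ) : ℝ :=
  (if (a, b) ∈ σ then -1 else 1) * (4 ^ ((b - a) * N + (N - a)) / 4 ^ (N * N + N))

/-- The weights on the pairs `a < b ≤ N`: light on `E`, with quadratic dependence on the length
and a small perturbation, and intermediate on the pairs with the hub `N`. -/
noncomputable def pairWeight (N : ℕ) (E σ : Finset (ℕ × ℕ)) (a b : ℕ) : ℝ :=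
  if b = N then 1.45
  else if (a, b) ∈ E then 1 + (5 * ((b : ℝ) - a) ^ 2 + pert N σ a b) / (100 * (N + 1) ^ 2)
  else 3

/-- The weights `pairWeight` as a function on unordered pairs. -/
noncomputable def hubWeight (N : ℕ) (E σ : Finset (ℕ × ℕ)) : Sym2 (Fin (N + 1)) → ℝ :=
  Sym2.lift ⟨fun i j => pairWeight N E σ (min i.1 j.1) (max i.1 j.1),
    fun i j => by simp only [min_comm, max_comm]⟩

variable {N : ℕ} {E σ : Finset (ℕ × ℕ)}

theorem abs_pert (a b : ℕ) :
    |pert N σ a b| = 4 ^ ((b - a) * N + (N - a)) / 4 ^ (N * N + N) := by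
  rw [pert, abs_mul, abs_of_pos (show (0 : ℝ) < 4 ^ ((b - a) * N + (N - a)) / 4 ^ (N * N + N) by
    positivity)]
  split_ifs <;> simp

theorem abs_pert_le {a b : ℕ} (hb : b < N) : |pert N σ a b| ≤ 1 := by
  rw [abs_pert, div_le_one (by positivity)]
  refine pow_le_pow_right₀ (by norm_num) ?_
  have : (b - a) * N ≤ N * N := Nat.mul_le_mul_right _ (by omega)
  omega

theorem four_mul_abs_pert_le {a b a' b' : ℕ}
    (h : (b' - a') * N + (N - a') < (b - a) * N + (N - a)) :
    4 * |pert N σ a' b'| ≤ |pert N σ a b| := by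
  rw [abs_pert, abs_pert, ← mul_div_assoc, ← pow_succ']
  exact div_le_div_of_nonneg_right (pow_le_pow_right₀ (by norm_num) h) (by positivity)

theorem pairWeight_of_mem {a b : ℕ} (hb : b < N) (h : (a, b) ∈ E) :
    pairWeight N E σ a b = 1 + (5 * ((b : ℝ) - a) ^ 2 + pert N σ a b) / (100 * (N + 1) ^ 2) := by
  rw [pairWeight, if_neg hb.ne, if_pos h]

theorem pairWeight_mem_bounds {a b : ℕ} (hab : a < b) (hb : b < N) (h : (a, b) ∈ E) :
    1 ≤ pairWeight N E σ a b ∧ pairWeight N E σ a b ≤ 1.1 := by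
  rw [pairWeight_of_mem hb h]
  have h1 := abs_le.1 (abs_pert_le (σ := σ) (a := a) hb)
  have h2 : (1 : ℝ) ≤ (b : ℝ) - a := by
    have : (a : ℝ) + 1 ≤ b := by exact_mod_cast hab
    linarith
  have h3 : (b : ℝ) - a ≤ N + 1 := by
    have : (b : ℝ) ≤ N := by exact_mod_cast hb.le
    have : (0 : ℝ) ≤ a := Nat.cast_nonneg a
    linarith
  have hpos : (0 : ℝ) < 100 * (N + 1) ^ 2 := by positivity
  constructor
  · have : 0 ≤ (5 * ((b : ℝ) - a) ^ 2 + pert N σ a b) / (100 * (N + 1) ^ 2) := by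
      apply div_nonneg _ hpos.le
      nlinarith
    linarith
  · have : (5 * ((b : ℝ) - a) ^ 2 + pert N σ a b) / (100 * (N + 1) ^ 2) ≤ 0.1 := by
      rw [div_le_iff₀ hpos]
      nlinarith
    linarith

theorem pairWeight_of_not_mem {a b : ℕ} (h : (a, b) ∉ E) : 1.45 ≤ pairWeight N E σ a b := by
  rw [pairWeight, if_neg h]
  split_ifs <;> norm_num

theorem one_le_pairWeight {a b : ℕ} (hab : a < b) (hb : b ≤ N) : 1 ≤ pairWeight N E σ a b := by
  rcases hb.lt_or_eq with hb | rfl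
  · by_cases h : (a, b) ∈ E
    · exact (pairWeight_mem_bounds hab hb h).1
    · linarith [pairWeight_of_not_mem (N := N) (σ := σ) h]
  · rw [pairWeight, if_pos rfl]; norm_num

theorem hubWeight_mk {i j : Fin (N + 1)} (h : i < j) :
    hubWeight N E σ s(i, j) = pairWeight N E σ i j := by
  have h' : i.1 < j.1 := h
  show pairWeight N E σ (min i.1 j.1) (max i.1 j.1) = _
  rw [min_eq_left h'.le, max_eq_right h'.le]

theorem one_le_hubWeight (u v : Fin (N + 1)) (h : u ≠ v) : 1 ≤ hubWeight N E σ s(u, v) := by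
  rcases lt_or_gt_of_ne h with h | h
  · rw [hubWeight_mk h]
    exact one_le_pairWeight h (Nat.le_of_lt_succ v.2)
  · rw [Sym2.eq_swap, hubWeight_mk h]
    exact one_le_pairWeight h (Nat.le_of_lt_succ u.2)

/-- Away from light pairs, weights are large; on them they are close to the quadratic function of
the length. -/
theorem hubWeight_lower (u v : Fin (N + 1)) (h : u ≠ v) :
    1.45 ≤ hubWeight N E σ s(u, v) ∨
      ((min u.1 v.1, max u.1 v.1) ∈ E ∧
        1 + (5 * ((v.1 : ℝ) - u.1) ^ 2 - 1) / (100 * (N + 1) ^ 2) ≤ hubWeight N E σ s(u, v)) := by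
  wlog huv : u < v generalizing u v
  · have h1 := this v u h.symm (lt_of_le_of_ne (not_lt.1 huv) h.symm)
    rw [Sym2.eq_swap, min_comm, max_comm, show ((v.1 : ℝ) - u.1) ^ 2 = (u.1 - v.1) ^ 2 by ring]
    exact h1
  rw [hubWeight_mk huv, min_eq_left (Fin.le_def.1 huv.le), max_eq_right (Fin.le_def.1 huv.le)]
  by_cases hmem : (u.1, v.1) ∈ E
  · by_cases hv : v.1 = N
    · left
      rw [pairWeight, if_pos hv]
    · right
      have hv : v.1 < N := lt_of_le_of_ne (Nat.le_of_lt_succ v.2) hv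
      refine ⟨hmem, ?_⟩
      rw [pairWeight_of_mem hv hmem]
      have h1 := (abs_le.1 (abs_pert_le (σ := σ) (a := u.1) hv)).1
      gcongr
      linarith
  · exact Or.inl (pairWeight_of_not_mem hmem)

/-- The vertices `x < y` are symmetric about the midpoint of `a` and `v` and are the
common neighbours of `a` and `v` in `E` that are nearest to it, while `(a, v)` is not in `E`. -/
structure IsTie (N : ℕ) (E : Finset (ℕ × ℕ)) (a x y v : ℕ) : Prop where
  lt₁ : a < x
  lt₂ : x < y
  lt₃ : y < v
  lt₄ : v < N
  add_eq : a + v = x + y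
  mem₁ : (a, x) ∈ E
  mem₂ : (x, v) ∈ E
  mem₃ : (a, y) ∈ E
  mem₄ : (y, v) ∈ E
  not_mem : (a, v) ∉ E
  near : y = x + 1 ∨ (y = x + 2 ∧ (a, x + 1) ∉ E)

/-- The pairs (a, y) and (x, v) have the same length and are the longest of the four; (a, y) starts
earlier, so its exponent is the largest. Each other term is at most a quarter of it, and 3/4 < 1. -/
theorem IsTie.pert_dominates {a x y v : ℕ} (h : IsTie N E a x y v) :
    |pert N σ a x| + |pert N σ x v| + |pert N σ y v| < |pert N σ a y| := by
  obtain ⟨h1, h2, h3, h4, h5, -, -, -, -, -, -⟩ := h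
  have e1 : (x - a) * N + N ≤ (y - a) * N := by
    rw [← Nat.succ_mul]; exact Nat.mul_le_mul_right _ (by omega)
  have e2 : v - x = y - a := by omega
  have e3 : v - y = x - a := by omega
  have r1 := four_mul_abs_pert_le (σ := σ) (a := a) (b := y) (a' := a) (b' := x) (N := N)
    (by omega)
  have r2 := four_mul_abs_pert_le (σ := σ) (a := a) (b := y) (a' := x) (b' := v) (N := N)
    (by rw [e2]; omega)
  have r3 := four_mul_abs_pert_le (σ := σ) (a := a) (b := y) (a' := y) (b' := v) (N := N)
    (by rw [e3]; omega)
  have : 0 < |pert N σ a y| := by rw [abs_pert]; positivity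
  linarith

theorem IsTie.next_eq {P : PathSystem (⊤ : SimpleGraph (Fin (N + 1)))}
    (hP : P.IsMinimizing (hubWeight N E σ)) {a x y v : Fin (N + 1)}
    (h : IsTie N E a x y v) :
    P.next a v = if (a.1, y.1) ∈ σ then y else x := by
  have hdom := h.pert_dominates (σ := σ)
  obtain ⟨h1, h2, h3, h4, h5, m1, m2, m3, m4, hnm, hnear⟩ := h
  have hxv : x.1 < v.1 := h2.trans h3
  have hay : a.1 < y.1 := h1.trans h2
  have hav : a.1 < v.1 := hay.trans h3
  have wx : hubWeight N E σ s(a, x) + hubWeight N E σ s(x, v) =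
      2 + (5 * (((x.1 : ℝ) - a.1) ^ 2 + ((v.1 : ℝ) - x.1) ^ 2) +
        (pert N σ a x + pert N σ x v)) / (100 * (N + 1) ^ 2) := by
    rw [hubWeight_mk (Fin.lt_def.2 h1), hubWeight_mk (Fin.lt_def.2 hxv),
      pairWeight_of_mem (hxv.trans h4) m1, pairWeight_of_mem h4 m2]
    ring
  -- By symmetry about the midpoint the quadratic part is the same as for x.
  have wy : hubWeight N E σ s(a, y) + hubWeight N E σ s(y, v) =
      2 + (5 * (((x.1 : ℝ) - a.1) ^ 2 + ((v.1 : ℝ) - x.1) ^ 2) +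
        (pert N σ a y + pert N σ y v)) / (100 * (N + 1) ^ 2) := by
    rw [hubWeight_mk (Fin.lt_def.2 hay), hubWeight_mk (Fin.lt_def.2 h3),
      pairWeight_of_mem (h3.trans h4) m3, pairWeight_of_mem h4 m4]
    have : (y.1 : ℝ) = a.1 + v.1 - x.1 := by
      have : (a.1 : ℝ) + v.1 = x.1 + y.1 := by exact_mod_cast h5
      linarith
    rw [this]
    ring
  have hle : ∀ z, (z = x ∨ z = y) → hubWeight N E σ s(a, z) + hubWeight N E σ s(z, v) ≤ 2.2 := by
    rintro z (rfl | rfl)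
    · rw [hubWeight_mk (Fin.lt_def.2 h1), hubWeight_mk (Fin.lt_def.2 hxv)]
      linarith [(pairWeight_mem_bounds (σ := σ) h1 (hxv.trans h4) m1).2,
        (pairWeight_mem_bounds (σ := σ) hxv h4 m2).2]
    · rw [hubWeight_mk (Fin.lt_def.2 hay), hubWeight_mk (Fin.lt_def.2 h3)]
      linarith [(pairWeight_mem_bounds (σ := σ) hay (h3.trans h4) m3).2,
        (pairWeight_mem_bounds (σ := σ) h3 h4 m4).2]
  have hedge : hubWeight N E σ s(a, v) = 3 := by
    rw [hubWeight_mk (Fin.lt_def.2 hav), pairWeight, if_neg h4.ne, if_neg hnm]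
  have hpos : (0 : ℝ) < 100 * (N + 1) ^ 2 := by positivity
  have bx1 := abs_le.1 (abs_pert_le (σ := σ) (a := a.1) (hxv.trans h4))
  have bx2 := abs_le.1 (abs_pert_le (σ := σ) (a := x.1) h4)
  have by1 := abs_le.1 (abs_pert_le (σ := σ) (a := a.1) (h3.trans h4))
  have by2 := abs_le.1 (abs_pert_le (σ := σ) (a := y.1) h4)
  have hother : ∀ z s : Fin (N + 1), (s = x ∨ s = y) → z ≠ a → z ≠ v → z ≠ x → z ≠ y →
      hubWeight N E σ s(a, s) + hubWeight N E σ s(s, v) <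
        hubWeight N E σ s(a, z) + hubWeight N E σ s(z, v) := by
    intro z s hs za zv zx zy
    have hs1 := hle s hs
    have g1 := one_le_hubWeight (E := E) (σ := σ) a z za.symm
    have g2 := one_le_hubWeight (E := E) (σ := σ) z v zv
    -- A detour with a pair outside E, in particular one through the hub, weighs at least 1.45 + 1 >
    -- 2.2.
    rcases hubWeight_lower (E := E) (σ := σ) a z za.symm with h6 | ⟨h6, h7⟩
    · linarith
    rcases hubWeight_lower (E := E) (σ := σ) z v zv with h8 | ⟨h8, h9⟩
    · linarith
    have hfar : z.1 + 1 ≤ x.1 ∨ y.1 + 1 ≤ z.1 := by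
      by_contra hc
      have hzx : z.1 ≠ x.1 := fun h => zx (Fin.ext h)
      have hzy : z.1 ≠ y.1 := fun h => zy (Fin.ext h)
      rcases hnear with hn | ⟨hn, hn'⟩
      · omega
      · have hz : z.1 = x.1 + 1 := by omega
        rw [min_eq_left (by omega), max_eq_right (by omega), hz] at h6
        exact hn' h6
    have hsum : (a.1 : ℝ) + v.1 = x.1 + y.1 := by exact_mod_cast h5
    have hxy : (x.1 : ℝ) + 1 ≤ y.1 := by exact_mod_cast h2
    -- A gap of 1, multiplied by the coefficient 5, exceeds 4, the largest total effect of the four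
    -- perturbations.
    have hquad : ((x.1 : ℝ) - a.1) ^ 2 + ((v.1 : ℝ) - x.1) ^ 2 + 1 ≤
        ((z.1 : ℝ) - a.1) ^ 2 + ((v.1 : ℝ) - z.1) ^ 2 := by
      have hv : (v.1 : ℝ) = x.1 + y.1 - a.1 := by linarith
      rw [hv]
      rcases hfar with h | h
      · have : (z.1 : ℝ) + 1 ≤ x.1 := by exact_mod_cast h
        nlinarith
      · have : (y.1 : ℝ) + 1 ≤ z.1 := by exact_mod_cast h
        nlinarith
    have hz : 2 + (5 * (((z.1 : ℝ) - a.1) ^ 2 + ((v.1 : ℝ) - z.1) ^ 2) - 2) /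
        (100 * (N + 1) ^ 2) ≤ hubWeight N E σ s(a, z) + hubWeight N E σ s(z, v) := by
      refine le_trans (le_of_eq ?_) (add_le_add h7 h9)
      ring
    refine lt_of_lt_of_le ?_ hz
    rcases hs with rfl | rfl
    · rw [wx]
      gcongr
      linarith
    · rw [wy]
      gcongr
      linarith
  have hmain : ∀ s s' : Fin (N + 1), (s = x ∧ s' = y ∨ s = y ∧ s' = x) →
      hubWeight N E σ s(a, s) + hubWeight N E σ s(s, v) <
        hubWeight N E σ s(a, s') + hubWeight N E σ s(s', v) → P.next a v = s := by
    intro s s' hs hlt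
    have hs1 : s = x ∨ s = y := by tauto
    have hle' := hle s hs1
    have hav' : a ≠ v := (Fin.lt_def.2 hav).ne
    refine hP.next_eq_mid one_le_hubWeight hav' ?_ ?_ (by linarith) (by rw [hedge]; linarith) ?_
    · rcases hs1 with rfl | rfl
      · exact (Fin.lt_def.2 h1).ne
      · exact (Fin.lt_def.2 hay).ne
    · rcases hs1 with rfl | rfl
      · exact (Fin.lt_def.2 hxv).ne
      · exact (Fin.lt_def.2 h3).ne
    · intro z za zv zs
      by_cases hz : z = s'
      · rw [hz]; exact hlt
      · refine hother z s hs1 za zv ?_ ?_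
        · rcases hs with ⟨rfl, rfl⟩ | ⟨rfl, rfl⟩ <;> assumption
        · rcases hs with ⟨rfl, rfl⟩ | ⟨rfl, rfl⟩ <;> assumption
  have c1 := neg_abs_le (pert N σ a x)
  have c2 := neg_abs_le (pert N σ x v)
  have c3 := neg_abs_le (pert N σ y v)
  have c4 := le_abs_self (pert N σ a x)
  have c5 := le_abs_self (pert N σ x v)
  have c6 := le_abs_self (pert N σ y v)
  by_cases hσ : (a.1, y.1) ∈ σ
  · rw [if_pos hσ]
    have : pert N σ a y = -|pert N σ a y| := by rw [abs_pert, pert, if_pos hσ]; ring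
    refine hmain y x (Or.inr ⟨rfl, rfl⟩) ?_
    rw [wx, wy]
    gcongr 2 + (5 * _ + ?_) / _
    linarith
  · rw [if_neg hσ]
    have : pert N σ a y = |pert N σ a y| := by rw [abs_pert, pert, if_neg hσ]; ring
    refine hmain x y (Or.inl ⟨rfl, rfl⟩) ?_
    rw [wx, wy]
    gcongr 2 + (5 * _ + ?_) / _
    linarith

/-- Outside E the edge weighs 3 and the hub detour 2.9; inside E the edge weighs less than any two
edges together. -/
theorem next_eq_iff_mem {P : PathSystem (⊤ : SimpleGraph (Fin (N + 1)))}
    (hP : P.IsMinimizing (hubWeight N E σ)) {a b : Fin (N + 1)} (hab : a < b) (hb : b.1 < N) :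
    P.next a b = b ↔ (a.1, b.1) ∈ E := by
  constructor
  · contrapose
    intro h
    have haN : a < Fin.last N := Fin.lt_def.2 ((Fin.lt_def.1 hab).trans hb)
    have hbN : b < Fin.last N := Fin.lt_def.2 hb
    refine hP.next_ne_of_detour hab.ne haN.ne hbN.ne' ?_
    rw [Sym2.eq_swap (a := Fin.last N), hubWeight_mk haN, hubWeight_mk hbN, hubWeight_mk hab,
      pairWeight, pairWeight, pairWeight, if_pos (Fin.val_last N), if_pos (Fin.val_last N),
      if_neg hb.ne, if_neg h]
    norm_num
  · intro h
    refine hP.next_eq_of_lt_two one_le_hubWeight hab.ne ?_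
    rw [hubWeight_mk hab]
    linarith [(pairWeight_mem_bounds (σ := σ) (Fin.lt_def.1 hab) hb h).2]

end TieWeights

/-! ### Lower bound: counting ties and averaging -/

section Counting

/-- The pairs `a < b` of natural numbers below `N`. -/
def ltPairs (N : ℕ) : Finset (ℕ × ℕ) :=
  (Finset.range N ×ˢ Finset.range N).filter fun p => p.1 < p.2

theorem mem_ltPairs {N a b : ℕ} : (a, b) ∈ ltPairs N ↔ a < b ∧ b < N := by
  simp only [ltPairs, Finset.mem_filter, Finset.mem_product, Finset.mem_range]
  omega

theorem card_ltPairs (N : ℕ) : ((ltPairs N).card : ℝ) = N * (N - 1) / 2 := by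
  have h : (ltPairs N).card = ∑ b ∈ Finset.range N, b := by
    rw [ltPairs, Finset.card_filter, Finset.sum_product_right]
    refine Finset.sum_congr rfl fun b hb => ?_
    rw [← Finset.card_filter]
    have : (Finset.range N).filter (· < b) = Finset.range b := by
      ext a
      simp only [Finset.mem_filter, Finset.mem_range] at hb ⊢
      omega
    rw [this, Finset.card_range]
  rw [h, Finset.sum_range_id, ← Nat.choose_two_right, Nat.cast_choose_two]

open Classical in
/-- The pairs `(a, y)` that are the upper pair of a tie in `E`. -/
noncomputable def tiePairs (N : ℕ) (E : Finset (ℕ × ℕ)) : Finset (ℕ × ℕ) :=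
  (ltPairs N).filter fun p => ∃ x v, IsTie N E p.1 x p.2 v

theorem sum_two_pow_card_tiePairs_le_ncard (N : ℕ) :
    ∑ E ∈ (ltPairs N).powerset, 2 ^ (tiePairs N E).card ≤
      (strictlyMetricSystemsOn (N + 1)).ncard := by
  classical
  have hex : ∀ p : (_ : Finset (ℕ × ℕ)) × Finset (ℕ × ℕ),
      ∃ P : PathSystem (⊤ : SimpleGraph (Fin (N + 1))),
        P.IsStrictlyMetric ∧ P.IsMinimizing (hubWeight N p.1 p.2) := by
    intro p
    refine exists_isStrictlyMetric_isMinimizing SimpleGraph.connected_top.preconnected fun e => ?_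
    induction e with
    | _ u v =>
      intro h
      have := one_le_hubWeight (E := p.1) (σ := p.2) u v (by simpa using h)
      linarith
  choose P hP hmin using hex
  have hcard : ((ltPairs N).powerset.sigma fun E => (tiePairs N E).powerset).card =
      ∑ E ∈ (ltPairs N).powerset, 2 ^ (tiePairs N E).card := by
    rw [Finset.card_sigma]
    simp
  rw [← hcard, Set.ncard_eq_toFinset_card _ (strictlyMetricSystemsOn_finite _)]
  refine Finset.card_le_card_of_injOn P (fun p _ => ?_) ?_
  · exact (strictlyMetricSystemsOn_finite _).mem_toFinset.2 (hP p)
  · rintro ⟨E, σ⟩ h ⟨E', σ'⟩ h' heq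
    simp only [Finset.coe_sigma, Set.mem_sigma_iff, Finset.mem_coe, Finset.mem_powerset] at h h'
    have m := hmin ⟨E, σ⟩
    have m' := hmin ⟨E', σ'⟩
    rw [← heq] at m'
    -- The single-edge paths recover E; only then are the tie pairs known, and the next vertices at
    -- the ties recover σ.
    have hE : E = E' := by
      have key : ∀ p ∈ ltPairs N, (p ∈ E ↔ p ∈ E') := by
        rintro ⟨a, b⟩ hab
        obtain ⟨h1, h2⟩ := mem_ltPairs.1 hab
        have k1 := next_eq_iff_mem m (a := ⟨a, by omega⟩) (b := ⟨b, by omega⟩) h1 h2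
        have k2 := next_eq_iff_mem m' (a := ⟨a, by omega⟩) (b := ⟨b, by omega⟩) h1 h2
        exact k1.symm.trans k2
      ext p
      exact ⟨fun hp => (key p (h.1 hp)).1 hp, fun hp => (key p (h'.1 hp)).2 hp⟩
    subst hE
    have hσ : σ = σ' := by
      have key : ∀ p ∈ tiePairs N E, (p ∈ σ ↔ p ∈ σ') := by
        rintro ⟨a, y⟩ hay
        obtain ⟨x, v, ht⟩ := (Finset.mem_filter.1 hay).2
        obtain ⟨h1, h2, h3, h4⟩ := And.intro ht.lt₁ (And.intro ht.lt₂ (And.intro ht.lt₃ ht.lt₄))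
        dsimp only at h1 h2 h3 h4
        have k1 := IsTie.next_eq m (a := ⟨a, by omega⟩) (x := ⟨x, by omega⟩)
          (y := ⟨y, by omega⟩) (v := ⟨v, by omega⟩) ht
        have k2 := IsTie.next_eq m' (a := ⟨a, by omega⟩) (x := ⟨x, by omega⟩)
          (y := ⟨y, by omega⟩) (v := ⟨v, by omega⟩) ht
        rw [k1] at k2
        split_ifs at k2 with c1 c2 c2
        · exact iff_of_true c1 c2
        · have := congrArg Fin.val k2
          dsimp only at this
          omega
        · have := congrArg Fin.val k2
          dsimp only at this
          omega
        · exact iff_of_false c1 c2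
      ext p
      exact ⟨fun hp => (key p (h.2 hp)).1 hp, fun hp => (key p (h'.2 hp)).2 hp⟩
    rw [hσ]

/-- The interval consists of the subsets of U that contain I and avoid J, so each prescribed element
halves the count. -/
theorem Finset.card_Icc_sdiff_mul {α : Type*} [DecidableEq α] {U I J : Finset α} (hI : I ⊆ U)
    (hJ : J ⊆ U) (h : Disjoint I J) :
    (Finset.Icc I (U \ J)).card * 2 ^ (I.card + J.card) = 2 ^ U.card := by
  have hsub : I ⊆ U \ J := Finset.subset_sdiff.2 ⟨hI, h⟩
  rw [Finset.card_Icc_finset hsub, ← pow_add, Finset.card_sdiff_of_subset hJ]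
  congr 1
  have h1 := Finset.card_le_card hsub
  rw [Finset.card_sdiff_of_subset hJ] at h1
  have := Finset.card_le_card hJ
  omega

open Classical in
-- Two disjoint patterns have upper pair (a, a + k + 3). With x = y - 1, four pairs are present and
-- one absent: density 1/32. With x = y - 2, the pair (a, y - 1) is absent too: density 1/64. The
-- first pattern contains (a, y - 1), hence disjointness.
theorem card_filter_isTie {N a k : ℕ} (h : a + 2 * k + 5 < N) :
    (3 / 64 : ℝ) * 2 ^ (ltPairs N).card ≤
      ((ltPairs N).powerset.filter fun E => ∃ x v, IsTie N E a x (a + k + 3) v).card := by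
  let I₁ : Finset (ℕ × ℕ) := {(a, a + k + 2), (a + k + 2, a + 2 * k + 5), (a, a + k + 3),
    (a + k + 3, a + 2 * k + 5)}
  let J₁ : Finset (ℕ × ℕ) := {(a, a + 2 * k + 5)}
  let I₂ : Finset (ℕ × ℕ) := {(a, a + k + 1), (a + k + 1, a + 2 * k + 4), (a, a + k + 3),
    (a + k + 3, a + 2 * k + 4)}
  let J₂ : Finset (ℕ × ℕ) := {(a, a + k + 2), (a, a + 2 * k + 4)}
  have hI₁ : I₁ ⊆ ltPairs N := by
    simp only [I₁, Finset.insert_subset_iff, Finset.singleton_subset_iff, mem_ltPairs]; omega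
  have hJ₁ : J₁ ⊆ ltPairs N := by
    simp only [J₁, Finset.singleton_subset_iff, mem_ltPairs]; omega
  have hI₂ : I₂ ⊆ ltPairs N := by
    simp only [I₂, Finset.insert_subset_iff, Finset.singleton_subset_iff, mem_ltPairs]; omega
  have hJ₂ : J₂ ⊆ ltPairs N := by
    simp only [J₂, Finset.insert_subset_iff, Finset.singleton_subset_iff, mem_ltPairs]; omega
  have c₁ := Finset.card_Icc_sdiff_mul hI₁ hJ₁ (by
    simp only [I₁, J₁, Finset.disjoint_singleton_right, Finset.mem_insert, Finset.mem_singleton,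
      Prod.mk.injEq]
    omega)
  have c₂ := Finset.card_Icc_sdiff_mul hI₂ hJ₂ (by
    simp only [I₂, J₂, Finset.disjoint_insert_right, Finset.disjoint_singleton_right,
      Finset.mem_insert, Finset.mem_singleton, Prod.mk.injEq]
    omega)
  have d₁ : I₁.card ≤ 4 := Finset.card_le_four
  have d₂ : I₂.card ≤ 4 := Finset.card_le_four
  have d₃ : J₁.card ≤ 1 := (Finset.card_singleton _).le
  have d₄ : J₂.card ≤ 2 := Finset.card_le_two
  have e₁ : 2 ^ (ltPairs N).card ≤ (Finset.Icc I₁ (ltPairs N \ J₁)).card * 32 := by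
    rw [← c₁]
    exact Nat.mul_le_mul_left _ ((Nat.pow_le_pow_right (by norm_num) (by omega)).trans_eq (by norm_num : 2 ^ 5 = 32))
  have e₂ : 2 ^ (ltPairs N).card ≤ (Finset.Icc I₂ (ltPairs N \ J₂)).card * 64 := by
    rw [← c₂]
    exact Nat.mul_le_mul_left _ ((Nat.pow_le_pow_right (by norm_num) (by omega)).trans_eq (by norm_num : 2 ^ 6 = 64))
  have hdisj : Disjoint (Finset.Icc I₁ (ltPairs N \ J₁)) (Finset.Icc I₂ (ltPairs N \ J₂)) := by
    rw [Finset.disjoint_left]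
    intro E h1 h2
    have m1 : (a, a + k + 2) ∈ E := (Finset.mem_Icc.1 h1).1 (by simp [I₁])
    have m2 := (Finset.mem_sdiff.1 ((Finset.mem_Icc.1 h2).2 m1)).2
    exact m2 (by simp [J₂])
  have hsub : Finset.Icc I₁ (ltPairs N \ J₁) ∪ Finset.Icc I₂ (ltPairs N \ J₂) ⊆
      (ltPairs N).powerset.filter fun E => ∃ x v, IsTie N E a x (a + k + 3) v := by
    intro E hE
    rw [Finset.mem_filter, Finset.mem_powerset]
    rcases Finset.mem_union.1 hE with hE | hE
    all_goals
      obtain ⟨h1, h2⟩ := Finset.mem_Icc.1 hE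
      have h3 := Finset.subset_sdiff.1 h2
      refine ⟨h3.1, ?_⟩
      have h4 := h3.2
      simp only [I₁, I₂, Finset.insert_subset_iff,
        Finset.singleton_subset_iff] at h1
      simp only [J₁, J₂, Finset.disjoint_insert_right, Finset.disjoint_singleton_right] at h4
      obtain ⟨m1, m2, m3, m4⟩ := h1
    · exact ⟨a + k + 2, a + 2 * k + 5, by omega, by omega, by omega, by omega, by omega,
        m1, m2, m3, m4, h4, Or.inl rfl⟩
    · exact ⟨a + k + 1, a + 2 * k + 4, by omega, by omega, by omega, by omega, by omega,
        m1, m2, m3, m4, h4.2, Or.inr ⟨rfl, h4.1⟩⟩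
  have hc := Finset.card_le_card hsub
  rw [Finset.card_union_of_disjoint hdisj] at hc
  have e₁' : (2 : ℝ) ^ (ltPairs N).card ≤ (Finset.Icc I₁ (ltPairs N \ J₁)).card * 32 := by
    exact_mod_cast e₁
  have e₂' : (2 : ℝ) ^ (ltPairs N).card ≤ (Finset.Icc I₂ (ltPairs N \ J₂)).card * 64 := by
    exact_mod_cast e₂
  have hc' : ((Finset.Icc I₁ (ltPairs N \ J₁)).card : ℝ) +
      (Finset.Icc I₂ (ltPairs N \ J₂)).card ≤
      ((ltPairs N).powerset.filter fun E => ∃ x v, IsTie N E a x (a + k + 3) v).card := by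
    exact_mod_cast hc
  linarith

theorem sum_card_tiePairs (N : ℕ) :
    (3 / 64 : ℝ) * ∑ k ∈ Finset.range (N / 2), ((N - (2 * k + 5) : ℕ) : ℝ) *
      2 ^ (ltPairs N).card ≤ ∑ E ∈ (ltPairs N).powerset, ((tiePairs N E).card : ℝ) := by
  classical
  -- The pair ⟨k, a⟩ stands for the candidate (a, a + k + 3); the range of a ensures a + 2k + 5 < N.
  let D := (Finset.range (N / 2)).sigma fun k => Finset.range (N - (2 * k + 5))
  have hle : ∀ E, (D.filter fun p => ∃ x v, IsTie N E p.2 x (p.2 + p.1 + 3) v).card ≤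
      (tiePairs N E).card := by
    intro E
    refine Finset.card_le_card_of_injOn (fun p => (p.2, p.2 + p.1 + 3)) ?_ ?_
    · rintro ⟨k, a⟩ h
      simp only [D, Finset.coe_filter, Finset.mem_sigma, Finset.mem_range, Set.mem_ofPred_eq] at h
      refine Finset.mem_filter.2 ⟨mem_ltPairs.2 ?_, h.2⟩
      dsimp only
      omega
    · rintro ⟨k, a⟩ _ ⟨k', a'⟩ _ h
      simp only [Prod.mk.injEq] at h
      obtain rfl : a = a' := h.1
      obtain rfl : k = k' := by omega
      rfl
  calc (3 / 64 : ℝ) * ∑ k ∈ Finset.range (N / 2), ((N - (2 * k + 5) : ℕ) : ℝ) *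
        2 ^ (ltPairs N).card
      = ∑ p ∈ D, (3 / 64 : ℝ) * 2 ^ (ltPairs N).card := by
        rw [Finset.sum_sigma, Finset.mul_sum]
        refine Finset.sum_congr rfl fun k _ => ?_
        rw [Finset.sum_const, Finset.card_range, nsmul_eq_mul]
        ring
    _ ≤ ∑ p ∈ D, (((ltPairs N).powerset.filter
          fun E => ∃ x v, IsTie N E p.2 x (p.2 + p.1 + 3) v).card : ℝ) := by
        refine Finset.sum_le_sum ?_
        rintro ⟨k, a⟩ h
        simp only [D, Finset.mem_sigma, Finset.mem_range] at h
        have h' : a + 2 * k + 5 < N := by omega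
        exact card_filter_isTie h'
    _ = ∑ E ∈ (ltPairs N).powerset,
          ((D.filter fun p => ∃ x v, IsTie N E p.2 x (p.2 + p.1 + 3) v).card : ℝ) := by
        simp only [Finset.card_filter, Nat.cast_sum]
        exact Finset.sum_comm
    _ ≤ _ := Finset.sum_le_sum fun E _ => by exact_mod_cast hle E

/-- The average of `2 ^ f` is at least `2 ^ t` if the average of `f` is at least `t`. -/
theorem card_mul_two_rpow_le_sum {ι : Type*} (s : Finset ι) (f : ι → ℝ) (t : ℝ)
    (h : t * s.card ≤ ∑ i ∈ s, f i) :
    (s.card : ℝ) * 2 ^ t ≤ ∑ i ∈ s, (2 : ℝ) ^ f i := by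
  have hlog : 0 ≤ Real.log 2 := Real.log_nonneg (by norm_num)
  -- The tangent line to 2 ^ x at t lies below the graph.
  have h1 : ∀ i ∈ s, (2 : ℝ) ^ t * (Real.log 2 * (f i - t) + 1) ≤ 2 ^ f i := by
    intro i _
    have h2 := Real.add_one_le_exp (Real.log 2 * (f i - t))
    rw [← Real.rpow_def_of_pos (by norm_num)] at h2
    calc (2 : ℝ) ^ t * (Real.log 2 * (f i - t) + 1) ≤ 2 ^ t * 2 ^ (f i - t) := by gcongr
      _ = 2 ^ f i := by rw [← Real.rpow_add (by norm_num)]; congr 1; ring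
  refine le_trans ?_ (Finset.sum_le_sum h1)
  rw [← Finset.mul_sum, Finset.sum_add_distrib, ← Finset.mul_sum, Finset.sum_sub_distrib,
    Finset.sum_const, Finset.sum_const, nsmul_eq_mul, nsmul_eq_mul, mul_comm]
  have h3 : 0 ≤ Real.log 2 * (∑ i ∈ s, f i - s.card * t) := mul_nonneg hlog (by linarith)
  have h4 : (0 : ℝ) < 2 ^ t := by positivity
  refine mul_le_mul_of_nonneg_left ?_ h4.le
  linarith

/-- Without truncation this is an equality, and truncated subtraction only increases the sum. At K =
N / 2 it is about N²/4. -/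
theorem sum_range_sub_ge (N K : ℕ) :
    (K : ℝ) * (N - 4 - K) ≤ ∑ k ∈ Finset.range K, ((N - (2 * k + 5) : ℕ) : ℝ) := by
  induction K with
  | zero => simp
  | succ K ih =>
    rw [Finset.sum_range_succ]
    have h : (N : ℝ) ≤ ((N - (2 * K + 5) : ℕ) : ℝ) + (2 * K + 5) := by
      exact_mod_cast (by omega : N ≤ N - (2 * K + 5) + (2 * K + 5))
    push_cast
    linarith

theorem two_rpow_le_ncard_strictlyMetricSystemsOn (N : ℕ) (hN : 8 ≤ N) :
    (2 : ℝ) ^ ((N : ℝ) * (N - 1) / 2 + 3 / 64 * ((N - 1) / 2 * (N / 2 - 4))) ≤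
      ((strictlyMetricSystemsOn (N + 1)).ncard : ℝ) := by
  have h1 : (∑ E ∈ (ltPairs N).powerset, (2 : ℝ) ^ ((tiePairs N E).card : ℝ)) ≤
      (strictlyMetricSystemsOn (N + 1)).ncard := by
    simp only [Real.rpow_natCast]
    exact_mod_cast sum_two_pow_card_tiePairs_le_ncard N
  refine le_trans ?_ h1
  rw [Real.rpow_add (by norm_num), ← card_ltPairs, Real.rpow_natCast]
  have hc : ((ltPairs N).powerset.card : ℝ) = 2 ^ (ltPairs N).card := by
    rw [Finset.card_powerset]; push_cast; rfl
  rw [← hc]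
  apply card_mul_two_rpow_le_sum
  refine le_trans ?_ (sum_card_tiePairs N)
  rw [← Finset.sum_mul, hc, ← mul_assoc (3 / 64 : ℝ) (∑ k ∈ _, _)]
  refine mul_le_mul_of_nonneg_right ?_ (by positivity)
  refine mul_le_mul_of_nonneg_left ?_ (by norm_num)
  refine le_trans ?_ (sum_range_sub_ge N (N / 2))
  have h2 : (N : ℝ) ≤ 2 * (N / 2 : ℕ) + 1 := by
    exact_mod_cast (by omega : N ≤ 2 * (N / 2) + 1)
  have h3 : 2 * ((N / 2 : ℕ) : ℝ) ≤ N := by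
    exact_mod_cast (by omega : 2 * (N / 2) ≤ N)
  have h4 : (8 : ℝ) ≤ N := by exact_mod_cast hN
  have h5 : ((N : ℝ) - 1) / 2 ≤ (N / 2 : ℕ) := by linarith
  have h6 : (N : ℝ) / 2 - 4 ≤ N - 4 - (N / 2 : ℕ) := by linarith
  exact mul_le_mul h5 h6 (by linarith) (Nat.cast_nonneg _)

theorem ncard_strictlyMetricSystemsOn_ge (n : ℕ) (hn : 2000 ≤ n) :
    (2 : ℝ) ^ ((0.51 : ℝ) * (n : ℝ) ^ 2) ≤ ((strictlyMetricSystemsOn n).ncard : ℝ) := by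
  obtain ⟨N, rfl⟩ : ∃ N, n = N + 1 := ⟨n - 1, by omega⟩
  refine le_trans ?_ (two_rpow_le_ncard_strictlyMetricSystemsOn N (by omega))
  refine Real.rpow_le_rpow_of_exponent_le (by norm_num) ?_
  have h : (1999 : ℝ) ≤ N := by exact_mod_cast (by omega : 1999 ≤ N)
  clear hn
  push_cast
  nlinarith [mul_nonneg (sub_nonneg.2 h) (sub_nonneg.2 h)]

theorem one_le_ncard_strictlyMetricSystemsOn (n : ℕ) :
    (1 : ℝ) ≤ (strictlyMetricSystemsOn n).ncard := by
  obtain ⟨P, hP, -⟩ := exists_isStrictlyMetric_isMinimizing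
    (G := (⊤ : SimpleGraph (Fin n))) (w := fun _ => 1)
    SimpleGraph.preconnected_top fun _ _ => one_pos
  have : 0 < (strictlyMetricSystemsOn n).ncard :=
    (Set.ncard_pos (strictlyMetricSystemsOn_finite n)).2 ⟨P, hP⟩
  exact_mod_cast this

end Counting

theorem theorem5p1 :
    ∃ ε δ : ℕ → ℝ,
      (∀ n, 0 ≤ ε n) ∧ (∀ n, 0 ≤ δ n) ∧
      Tendsto ε atTop (𝓝 0) ∧ Tendsto δ atTop (𝓝 0) ∧
      ∀ n : ℕ,
        (strictlyMetricSystemsOn n).Finite ∧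
        (2 : ℝ) ^ ((0.51 : ℝ) * (n : ℝ) ^ 2 * (1 - ε n)) ≤
            ((strictlyMetricSystemsOn n).ncard : ℝ) ∧
        ((strictlyMetricSystemsOn n).ncard : ℝ) ≤
            (2 : ℝ) ^ ((1.38 : ℝ) * (n : ℝ) ^ 2 * (1 - δ n)) := by
  -- For n < 2000 the value ε = 1 reduces the lower bound to the existence of one system; from 2000
  -- on, the surplus of 1/2 + 3/256 over 0.51 absorbs the linear terms.
  refine ⟨fun n => if 2000 ≤ n then 0 else 1, fun _ => 0, fun n => ?_, fun _ => le_rfl, ?_,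
    tendsto_const_nhds, fun n => ⟨strictlyMetricSystemsOn_finite n, ?_, ?_⟩⟩
  · dsimp only
    split_ifs <;> norm_num
  · refine tendsto_const_nhds.congr' ?_
    filter_upwards [eventually_ge_atTop 2000] with n hn
    rw [if_pos hn]
  · dsimp only
    split_ifs with hn
    · simpa using ncard_strictlyMetricSystemsOn_ge n hn
    · simpa using one_le_ncard_strictlyMetricSystemsOn n
  · simpa using ncard_strictlyMetricSystemsOn_le n
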